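/- Let $n\ge 2$ and let $S=\{|\psi_1\rangle,\dots,|\psi_n\rangle\}$ be an orthonormal basis of $\mathbb C^{d_A}\otimes\mathbb C^{d_B}$ (so $n=d_Ad_B$). For positive semidefinite $a$ on $\mathbb C^{d_A}$ and $b$ on $\mathbb C^{d_B}$ with $\langle\psi_i|a\otimes b|\psi_i\rangle\ne 0$ for all $i$, put $$\delta_S(a\otimes b)=\max_{i\ne j}\frac{|\langle\psi_i|a\otimes b|\psi_j\rangle|}{\sqrt{\langle\psi_i|a\otimes b|\psi_i\rangle\,\langle\psi_j|a\otimes b|\psi_j\rangle}} .$$ For a real number $c$, call $S$ *$c$-rigid* if for all such $a,b$ $$\Bigl\|\frac{a\otimes b}{\operatorname{tr}(a\otimes b)}-\frac{I}{n}\Bigr\|_{\max}\le c\,\delta_S(a\otimes b),$$ where $\|M\|_{\max}$ is the largest absolute value of an entry of $M$ in the computational product basis $|r\rangle|s\rangle$. Let the tile of a state be its support $\{(r,s):\langle r,s|\psi\rangle\neq0\}\subseteq[d_A]\times[d_B]$ (for a product state this is the rectangle $\operatorname{supp}\alpha\times\operatorname{supp}\beta$), and let $L$ be the largest cardinality of a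 tile of a state in $S$. An $n$-outcome *LOCC measurement* is a POVM $\{E_1,\dots,E_n\}$ implemented by a finite protocol tree: at each inner node one of the two parties applies to its own system a measurement $\{M_1,\dots,M_r\}$, $M_i\in\mathrm{Lin}(\mathbb C^{d},\mathbb C^{d'})$, $\sum_i M_i^\dagger M_i=I$, and announces the outcome, on which the continuation may depend; each leaf $m$ is labelled by an outcome $k\in[n]$; and $E_k=\sum_m A_m^\dagger A_m\otimes B_m^\dagger B_m$, summed over the leaves $m$ labelled $k$, where $A_m$ and $B_m$ are the products of Alice's and Bob's operators along the branch ending at $m$. **Theorem.** If $S$ is $c$-rigid, then every LOCC measurement $\{E_1,\dots,E_n\}$ for discriminating states drawn uniformly from $S$ errs with probability $$p_{\mathrm{error}}=1-\frac1n\sum_{k=1}^n\langle\psi_k|E_k|\psi_k\rangle\;\ge\;\frac{2}{27}\,\frac{1}{(cL)^2\,n^5}.$$ -/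

import Mathlib

open scoped Kronecker Matrix ComplexOrder

namespace BipartiteLOCC

/-- The space `ℂ^dA ⊗ ℂ^dB`, in coordinates with respect to the computational product basis:
vectors are indexed by the cells of the `dA × dB` grid, and `a ⊗ b` acts as the Kronecker
product `a ⊗ₖ b`. -/
abbrev Bip (dA dB : ℕ) : Type := EuclideanSpace ℂ (Fin dA × Fin dB)

/-- Operators on `ℂ^dA ⊗ ℂ^dB`. -/
abbrev BipOp (dA dB : ℕ) : Type := Matrix (Fin dA × Fin dB) (Fin dA × Fin dB) ℂ

/-- The matrix element `⟨φ| E |χ⟩` (conjugate-linear in `φ`). -/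
def braket {dA dB : ℕ} (E : BipOp dA dB) (φ χ : Bip dA dB) : ℂ :=
  star φ.ofLp ⬝ᵥ (E *ᵥ χ.ofLp)

/-- A finite two-party LOCC protocol, as a finite tree, for parties currently holding systems of
dimensions `dA` and `dB`. At each node the protocol either terminates and outputs an element of
`K`, or one of the two parties applies a non-destructive measurement
`{M_1, …, M_r} ⊂ Lin(ℂ^d, ℂ^d')` with `∑ M_i† M_i = I` (any finite output dimension `d'`) to its
own system and announces the outcome `i`, on which the rest of the protocol depends. Strictly
alternating turns, with either party starting, are the special case in which the acting party
alternates. -/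
inductive Protocol (K : Type) : ℕ → ℕ → Type
  | output {dA dB : ℕ} (k : K) : Protocol K dA dB
  | alice {dA dB : ℕ} (r d' : ℕ) (M : Fin r → Matrix (Fin d') (Fin dA) ℂ)
      (complete : ∑ i, (M i)ᴴ * M i = 1) (next : Fin r → Protocol K d' dB) : Protocol K dA dB
  | bob {dA dB : ℕ} (r d' : ℕ) (M : Fin r → Matrix (Fin d') (Fin dB) ℂ)
      (complete : ∑ i, (M i)ᴴ * M i = 1) (next : Fin r → Protocol K dA d') : Protocol K dA dB

/-- `P.leafSum k A B` is the sum of `A_m† A_m ⊗ B_m† B_m` over all leaves `m` of `P` with output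
`k`, where `A ⊗ B` is the measurement operator that has been implemented upon reaching the root of
`P`, and `A_m ⊗ B_m` the one upon reaching the leaf `m`. -/
noncomputable def Protocol.leafSum {K : Type} [DecidableEq K] {DA DB : ℕ} (k : K) :
    {dA dB : ℕ} → Protocol K dA dB → Matrix (Fin dA) (Fin DA) ℂ → Matrix (Fin dB) (Fin DB) ℂ →
      BipOp DA DB
  | _, _, .output j, A, B => if j = k then (Aᴴ * A) ⊗ₖ (Bᴴ * B) else 0
  | _, _, .alice _ _ M _ next, A, B => ∑ i, leafSum k (next i) (M i * A) B
  | _, _, .bob _ _ M _ next, A, B => ∑ i, leafSum k (next i) A (M i * B)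

/-- The POVM element `E_k` implemented by an LOCC protocol. -/
noncomputable def Protocol.povm {K : Type} [DecidableEq K] {dA dB : ℕ} (P : Protocol K dA dB)
    (k : K) : BipOp dA dB :=
  P.leafSum k 1 1

/-- `E = {E_1, …, E_n}` is an (`n`-outcome) LOCC measurement. -/
def IsLOCCMeasurement {n dA dB : ℕ} (E : Fin n → BipOp dA dB) : Prop :=
  ∃ P : Protocol (Fin n) dA dB, ∀ k, E k = P.povm k

/-- The error probability of the measurement `E` for discriminating the states `ψ_1, …, ψ_n`:
the probability that the outcome differs from `k` when `k` is uniformly random and `E` is applied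
to `ψ_k`. -/
noncomputable def errorProb {n dA dB : ℕ} (ψ : Fin n → Bip dA dB) (E : Fin n → BipOp dA dB) : ℝ :=
  1 - (1 / (n : ℝ)) * ∑ k, (braket (E k) (ψ k) (ψ k)).re

/-- The disturbance `δ_S(E)`, used where all `⟨ψ_i| E |ψ_i⟩` are positive and `n ≥ 2`. The
supremum is a maximum over finitely many pairs. -/
noncomputable def disturbance {n dA dB : ℕ} (ψ : Fin n → Bip dA dB) (E : BipOp dA dB) : ℝ :=
  ⨆ p : {p : Fin n × Fin n // p.1 ≠ p.2},
    ‖braket E (ψ p.1.1) (ψ p.1.2)‖ /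
      Real.sqrt ((braket E (ψ p.1.1) (ψ p.1.1)).re * (braket E (ψ p.1.2) (ψ p.1.2)).re)

/-- The largest absolute value of an entry of `M`. -/
noncomputable def maxNorm {dA dB : ℕ} (M : BipOp dA dB) : ℝ :=
  ⨆ p : (Fin dA × Fin dB) × (Fin dA × Fin dB), ‖M p.1 p.2‖

/-- `S = {ψ_1, …, ψ_n}` is `c`-rigid: for all positive semidefinite `a`, `b` such that
`⟨ψ_i| a ⊗ b |ψ_i⟩ ≠ 0` for all `i`,
`‖(a ⊗ b) / tr (a ⊗ b) - I / n‖_max ≤ c δ_S(a ⊗ b)`. -/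
def IsRigid {n dA dB : ℕ} (c : ℝ) (ψ : Fin n → Bip dA dB) : Prop :=
  ∀ (a : Matrix (Fin dA) (Fin dA) ℂ) (b : Matrix (Fin dB) (Fin dB) ℂ),
    a.PosSemidef → b.PosSemidef → (∀ i, braket (a ⊗ₖ b) (ψ i) (ψ i) ≠ 0) →
      maxNorm ((a ⊗ₖ b).trace⁻¹ • (a ⊗ₖ b) - (n : ℂ)⁻¹ • (1 : BipOp dA dB)) ≤
        c * disturbance ψ (a ⊗ₖ b)

/-- The tile of a state: its support in the `dA × dB` grid. For a product state `α ⊗ β` it is the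
rectangle `supp α × supp β`. -/
def tile {dA dB : ℕ} (φ : Bip dA dB) : Set (Fin dA × Fin dB) :=
  {x | φ x ≠ 0}

/-- The size of the largest tile of `S = {ψ_1, …, ψ_n}`. -/
noncomputable def largestTileSize {n dA dB : ℕ} (ψ : Fin n → Bip dA dB) : ℕ :=
  Finset.univ.sup fun i => (tile (ψ i)).ncard

end BipartiteLOCC

namespace BipartiteLOCC

/-! ### Matrix elements in an orthonormal basis -/

variable {n dA dB : ℕ}

/-! After an event with operator E = a ⊗ b, the posterior probability of ψ_k is ⟨ψ_k|E|ψ_k⟩ / tr E,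
which is 1/n at the root. Put θ = 1/n + `posteriorGap n`. If the largest posterior is exactly θ,
rigidity forces a disturbance of at least `posteriorGap n` / (cL), and two states that overlap this
much cannot be told apart well by any continuation: the error is at least a constant times tr E
(`le_errorWeight_of_posterior_eq`).

A measurement may jump past θ, so no node need sit exactly there. `le_errorWeight_sum` handles this
by reweighting. If a node errs too little, so does one of its children, and by induction that child
has a posterior above θ. Adding t times the child to the node, with t tuned so that the largest
posterior is θ, gives an event that still errs too little, because the error weight is linear. Only
one party acts at a node, so the new operator is still a product, which contradicts the bound at θ.
At a leaf the error probability is at least 1 - θ. Induction on the tree (`Protocol.le_errorWeight`)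
then gives the bound at the root. -/

theorem braket_add (E F : BipOp dA dB) (φ χ : Bip dA dB) :
    braket (E + F) φ χ = braket E φ χ + braket F φ χ := by
  simp [braket, Matrix.add_mulVec, dotProduct_add]

theorem braket_smul (t : ℂ) (E : BipOp dA dB) (φ χ : Bip dA dB) :
    braket (t • E) φ χ = t * braket E φ χ := by
  simp [braket, Matrix.smul_mulVec, dotProduct_smul]

theorem braket_sum {ι : Type*} (s : Finset ι) (E : ι → BipOp dA dB) (φ χ : Bip dA dB) :
    braket (∑ i ∈ s, E i) φ χ = ∑ i ∈ s, braket (E i) φ χ := by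
  simp [braket, Matrix.sum_mulVec, dotProduct_sum]

theorem braket_eq_inner (E : BipOp dA dB) (φ χ : Bip dA dB) :
    braket E φ χ = inner ℂ φ (Matrix.toLpLin 2 2 E χ) := by
  rw [braket, EuclideanSpace.inner_eq_star_dotProduct, dotProduct_comm]
  rfl

theorem braket_one (φ χ : Bip dA dB) : braket 1 φ χ = inner ℂ φ χ := by
  rw [braket, EuclideanSpace.inner_eq_star_dotProduct, dotProduct_comm, Matrix.one_mulVec]

theorem braket_re_nonneg {F : BipOp dA dB} (hF : F.PosSemidef) (φ : Bip dA dB) :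
    0 ≤ (braket F φ φ).re :=
  hF.re_dotProduct_nonneg φ.ofLp

open scoped MatrixOrder Matrix.Norms.L2Operator in
/-- The Cauchy–Schwarz inequality for the sesquilinear form of a positive semidefinite operator. -/
theorem norm_braket_le {F : BipOp dA dB} (hF : F.PosSemidef) (φ χ : Bip dA dB) :
    ‖braket F φ χ‖ ≤ √((braket F φ φ).re * (braket F χ χ).re) := by
  obtain ⟨C, rfl⟩ : ∃ C, F = Cᴴ * C := CStarAlgebra.nonneg_iff_eq_star_mul_self.mp hF.nonneg
  have key (φ χ : Bip dA dB) : braket (Cᴴ * C) φ χ =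
      inner ℂ (Matrix.toLpLin 2 2 C φ) (Matrix.toLpLin 2 2 C χ) := by
    rw [braket, EuclideanSpace.inner_eq_star_dotProduct, ← Matrix.mulVec_mulVec,
      Matrix.dotProduct_mulVec, ← Matrix.star_mulVec]
    exact dotProduct_comm _ _
  have hre (φ : Bip dA dB) : (braket (Cᴴ * C) φ φ).re = ‖Matrix.toLpLin 2 2 C φ‖ ^ 2 := by
    rw [key, inner_self_eq_norm_sq_to_K]
    norm_cast
  rw [hre, hre, key, ← mul_pow, Real.sqrt_sq (by positivity)]
  exact norm_inner_le_norm _ _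

theorem sum_braket_eq_trace (ψ : OrthonormalBasis (Fin n) ℂ (Bip dA dB)) (E : BipOp dA dB) :
    ∑ k, braket E (ψ k) (ψ k) = E.trace := by
  have h := LinearMap.trace_eq_sum_inner (Matrix.toLpLin 2 2 E) ψ
  rw [Matrix.toLpLin_eq_toLin, LinearMap.trace_eq_matrix_trace ℂ (PiLp.basisFun 2 ℂ _),
    LinearMap.toMatrix_toLin] at h
  rw [h]
  exact Finset.sum_congr rfl fun k _ => by rw [braket_eq_inner, Matrix.toLpLin_eq_toLin]

theorem sum_braket_re (ψ : OrthonormalBasis (Fin n) ℂ (Bip dA dB)) (E : BipOp dA dB) :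
    ∑ k, (braket E (ψ k) (ψ k)).re = E.trace.re := by
  rw [← sum_braket_eq_trace ψ, Complex.re_sum]

theorem card_eq_mul (ψ : OrthonormalBasis (Fin n) ℂ (Bip dA dB)) : n = dA * dB := by
  have h := Module.finrank_eq_card_basis ψ.toBasis
  simpa using h.symm

/-! ### POVM elements of a protocol -/

theorem Protocol.leafSum_posSemidef {K : Type} [DecidableEq K] {DA DB : ℕ} (k : K)
    {dA dB : ℕ} (P : Protocol K dA dB) (A : Matrix (Fin dA) (Fin DA) ℂ)
    (B : Matrix (Fin dB) (Fin DB) ℂ) : (P.leafSum k A B).PosSemidef := by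
  induction P with
  | output j =>
    rw [Protocol.leafSum]
    split_ifs
    · exact (Matrix.posSemidef_conjTranspose_mul_self A).kronecker
        (Matrix.posSemidef_conjTranspose_mul_self B)
    · exact Matrix.PosSemidef.zero
  | alice r d' M hM next ih =>
    rw [Protocol.leafSum]
    exact Matrix.posSemidef_sum _ fun i _ => ih i _ _
  | bob r d' M hM next ih =>
    rw [Protocol.leafSum]
    exact Matrix.posSemidef_sum _ fun i _ => ih i _ _

theorem sum_conjTranspose_mul_self_mul {r d d' D : ℕ} (M : Fin r → Matrix (Fin d') (Fin d) ℂ)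
    (hM : ∑ i, (M i)ᴴ * M i = 1) (A : Matrix (Fin d) (Fin D) ℂ) :
    ∑ i, (M i * A)ᴴ * (M i * A) = Aᴴ * A := by
  calc ∑ i, (M i * A)ᴴ * (M i * A) = Aᴴ * (∑ i, (M i)ᴴ * M i) * A := by
        simp only [Matrix.conjTranspose_mul, Matrix.mul_sum, Matrix.sum_mul, Matrix.mul_assoc]
    _ = Aᴴ * A := by rw [hM, Matrix.mul_one]

theorem sum_kronecker {ι : Type*} {m₁ m₂ : Type*} (s : Finset ι) (a : ι → Matrix m₁ m₁ ℂ)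
    (b : Matrix m₂ m₂ ℂ) : (∑ i ∈ s, a i) ⊗ₖ b = ∑ i ∈ s, a i ⊗ₖ b := by
  ext; simp [Matrix.sum_apply, Finset.sum_mul]

theorem kronecker_sum {ι : Type*} {m₁ m₂ : Type*} (s : Finset ι) (a : Matrix m₁ m₁ ℂ)
    (b : ι → Matrix m₂ m₂ ℂ) : a ⊗ₖ (∑ i ∈ s, b i) = ∑ i ∈ s, a ⊗ₖ b i := by
  ext; simp [Matrix.sum_apply, Finset.mul_sum]

theorem Protocol.sum_leafSum {K : Type} [DecidableEq K] [Fintype K] {DA DB : ℕ}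
    {dA dB : ℕ} (P : Protocol K dA dB) (A : Matrix (Fin dA) (Fin DA) ℂ)
    (B : Matrix (Fin dB) (Fin DB) ℂ) : ∑ k, P.leafSum k A B = (Aᴴ * A) ⊗ₖ (Bᴴ * B) := by
  induction P with
  | output j => simp [Protocol.leafSum]
  | alice r d' M hM next ih =>
    simp only [Protocol.leafSum]
    rw [Finset.sum_comm, ← sum_conjTranspose_mul_self_mul M hM A, sum_kronecker]
    exact Finset.sum_congr rfl fun i _ => ih i _ _
  | bob r d' M hM next ih =>
    simp only [Protocol.leafSum]
    rw [Finset.sum_comm, ← sum_conjTranspose_mul_self_mul M hM B, kronecker_sum]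
    exact Finset.sum_congr rfl fun i _ => ih i _ _

/-! ### Error weight and overlaps -/

/-- The unnormalised error of answering `k` upon the event `F k`. -/
noncomputable def errorWeight (ψ : Fin n → Bip dA dB) (F : Fin n → BipOp dA dB) : ℝ :=
  (∑ k, F k).trace.re - ∑ k, (braket (F k) (ψ k) (ψ k)).re

theorem errorWeight_sum {ι : Type*} (s : Finset ι) (ψ : Fin n → Bip dA dB)
    (F : ι → Fin n → BipOp dA dB) :
    errorWeight ψ (fun k => ∑ i ∈ s, F i k) = ∑ i ∈ s, errorWeight ψ (F i) := by
  simp only [errorWeight, braket_sum, Matrix.trace_sum, Complex.re_sum, Finset.sum_sub_distrib]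
  congr 1 <;> exact Finset.sum_comm

/-- This linearity is what allows a branch to be given extra weight. -/
theorem errorWeight_add_smul (ψ : Fin n → Bip dA dB) (F G : Fin n → BipOp dA dB) (t : ℝ) :
    errorWeight ψ (fun k => F k + (t : ℂ) • G k) = errorWeight ψ F + t * errorWeight ψ G := by
  simp only [errorWeight, braket_add, braket_smul, Finset.sum_add_distrib, Matrix.trace_add,
    ← Finset.smul_sum, Matrix.trace_smul, smul_eq_mul, Complex.add_re, Complex.re_ofReal_mul,
    ← Finset.mul_sum]
  ring

/-- Two states with a large overlap after the event `∑ k, F k` cause a large error. -/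
theorem norm_braket_sq_le_errorWeight (ψ : OrthonormalBasis (Fin n) ℂ (Bip dA dB))
    (F : Fin n → BipOp dA dB) (hF : ∀ k, (F k).PosSemidef) {i j : Fin n} (hij : i ≠ j) :
    ‖braket (∑ k, F k) (ψ i) (ψ j)‖ ^ 2 ≤
      ((braket (∑ k, F k) (ψ i) (ψ i)).re + (braket (∑ k, F k) (ψ j) (ψ j)).re) *
        errorWeight ψ F := by
  -- Only two outcomes matter, "i" and "not i": `F i` is an error on ψ_i's rival ψ_j, and `H` is an
  -- error on ψ_i.
  set H := ∑ k ∈ Finset.univ.erase i, F k with hH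
  have hHpos : H.PosSemidef := Matrix.posSemidef_sum _ fun k _ => hF k
  have hsum : ∑ k, F k = F i + H := (Finset.add_sum_erase _ _ (Finset.mem_univ i)).symm
  have herr : (braket H (ψ i) (ψ i)).re + (braket (F i) (ψ j) (ψ j)).re ≤ errorWeight ψ F := by
    have hnn : ∀ k, 0 ≤ (braket (∑ k, F k) (ψ k) (ψ k)).re - (braket (F k) (ψ k) (ψ k)).re := by
      intro k
      rw [braket_sum, Complex.re_sum, sub_nonneg]
      exact Finset.single_le_sum (f := fun l => (braket (F l) (ψ k) (ψ k)).re)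
        (fun l _ => braket_re_nonneg (hF l) _) (Finset.mem_univ k)
    have hj : (braket (F i) (ψ j) (ψ j)).re ≤
        (braket (∑ k, F k) (ψ j) (ψ j)).re - (braket (F j) (ψ j) (ψ j)).re := by
      rw [braket_sum, Complex.re_sum, ← Finset.add_sum_erase _ _ (Finset.mem_univ j),
        add_sub_cancel_left]
      exact Finset.single_le_sum (f := fun l => (braket (F l) (ψ j) (ψ j)).re)
        (fun l _ => braket_re_nonneg (hF l) _) (Finset.mem_erase.2 ⟨hij, Finset.mem_univ i⟩)
    have hi : (braket H (ψ i) (ψ i)).re =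
        (braket (∑ k, F k) (ψ i) (ψ i)).re - (braket (F i) (ψ i) (ψ i)).re := by
      rw [hsum, braket_add, Complex.add_re, add_sub_cancel_left]
    rw [errorWeight, ← sum_braket_re ψ, ← Finset.sum_sub_distrib]
    have hp := Finset.sum_le_sum_of_subset_of_nonneg (Finset.subset_univ {i, j})
      (f := fun k => (braket (∑ k, F k) (ψ k) (ψ k)).re - (braket (F k) (ψ k) (ψ k)).re)
      fun k _ _ => hnn k
    rw [Finset.sum_pair hij] at hp
    linarith
  have hG := norm_braket_le (hF i) (ψ i) (ψ j)
  have hH' := norm_braket_le hHpos (ψ i) (ψ j)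
  have g₁ := braket_re_nonneg (hF i) (ψ i)
  have g₂ := braket_re_nonneg (hF i) (ψ j)
  have h₁ := braket_re_nonneg hHpos (ψ i)
  have h₂ := braket_re_nonneg hHpos (ψ j)
  rw [hsum]
  simp only [braket_add, Complex.add_re]
  have hn := norm_add_le (braket (F i) (ψ i) (ψ j)) (braket H (ψ i) (ψ j))
  generalize (braket (F i) (ψ i) (ψ i)).re = x₁ at *
  generalize (braket (F i) (ψ j) (ψ j)).re = y₁ at *
  generalize (braket H (ψ i) (ψ i)).re = x₂ at *
  generalize (braket H (ψ j) (ψ j)).re = y₂ at *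
  have hle : ‖braket (F i) (ψ i) (ψ j) + braket H (ψ i) (ψ j)‖ ≤ √(x₁ * y₁) + √(x₂ * y₂) := by
    linarith
  calc _ ≤ (√(x₁ * y₁) + √(x₂ * y₂)) ^ 2 := by gcongr
    -- Cauchy–Schwarz for (√x₁, √y₂) and (√y₁, √x₂), paired so that the second factor is the error
    -- x₂ + y₁.
    _ ≤ (x₁ + y₂) * (x₂ + y₁) := by
      have e₁ := Real.sq_sqrt (mul_nonneg g₁ g₂)
      have e₂ := Real.sq_sqrt (mul_nonneg h₁ h₂)
      have e₃ : 2 * (√(x₁ * y₁) * √(x₂ * y₂)) ≤ x₁ * x₂ + y₁ * y₂ := by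
        rw [← Real.sqrt_mul (mul_nonneg g₁ g₂),
          show x₁ * y₁ * (x₂ * y₂) = (x₁ * x₂) * (y₁ * y₂) by ring]
        have p := mul_nonneg g₁ h₁
        have q := mul_nonneg g₂ h₂
        rw [Real.sqrt_mul p]
        nlinarith [sq_nonneg (√(x₁ * x₂) - √(y₁ * y₂)), Real.sq_sqrt p, Real.sq_sqrt q]
      nlinarith
    _ ≤ (x₁ + x₂ + (y₁ + y₂)) * (x₂ + y₁) := by gcongr <;> linarith
    _ ≤ _ := by gcongr

/-! ### Disturbance, largest entry and tiles -/

theorem exists_disturbance_eq (hn : 2 ≤ n) (ψ : Fin n → Bip dA dB) (E : BipOp dA dB) :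
    ∃ i j, i ≠ j ∧ disturbance ψ E = ‖braket E (ψ i) (ψ j)‖ /
      √((braket E (ψ i) (ψ i)).re * (braket E (ψ j) (ψ j)).re) := by
  have : Nonempty {p : Fin n × Fin n // p.1 ≠ p.2} :=
    ⟨⟨(⟨0, by omega⟩, ⟨1, by omega⟩), by simp⟩⟩
  obtain ⟨p, hp⟩ := exists_eq_ciSup_of_finite (f := fun p : {p : Fin n × Fin n // p.1 ≠ p.2} =>
    ‖braket E (ψ p.1.1) (ψ p.1.2)‖ /
      √((braket E (ψ p.1.1) (ψ p.1.1)).re * (braket E (ψ p.1.2) (ψ p.1.2)).re))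
  exact ⟨_, _, p.2, hp.symm⟩

theorem disturbance_le_one (hn : 2 ≤ n) (ψ : Fin n → Bip dA dB) {E : BipOp dA dB}
    (hE : E.PosSemidef) : disturbance ψ E ≤ 1 := by
  obtain ⟨i, j, -, h⟩ := exists_disturbance_eq hn ψ E
  rw [h]
  exact div_le_one_of_le₀ (norm_braket_le hE _ _) (Real.sqrt_nonneg _)

theorem norm_apply_le_maxNorm (M : BipOp dA dB) (x y : Fin dA × Fin dB) : ‖M x y‖ ≤ maxNorm M :=
  le_ciSup (f := fun p : (Fin dA × Fin dB) × (Fin dA × Fin dB) => ‖M p.1 p.2‖)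
    (Set.finite_range _).bddAbove (x, y)

theorem maxNorm_nonneg (M : BipOp dA dB) : 0 ≤ maxNorm M :=
  Real.iSup_nonneg fun _ => norm_nonneg _

/-- The form is at most the largest entry times the squared ℓ¹ norm of φ. By Cauchy–Schwarz on the
support, a unit vector has squared ℓ¹ norm at most the tile size. -/
theorem norm_braket_le_maxNorm (M : BipOp dA dB) (φ : Bip dA dB) (hφ : ‖φ‖ = 1) :
    ‖braket M φ φ‖ ≤ (tile φ).ncard * maxNorm M := by
  classical
  set s : Finset (Fin dA × Fin dB) := Finset.univ.filter fun x => φ x ≠ 0 with hs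
  have hcard : (tile φ).ncard = s.card := by
    rw [← Set.ncard_coe_finset]; congr 1; ext; simp [hs, tile]
  have hsupp : ∑ x, ‖φ x‖ = ∑ x ∈ s, ‖φ x‖ := by
    rw [hs, Finset.sum_filter_of_ne]
    simp
  have hsq : (∑ x, ‖φ x‖) ^ 2 ≤ s.card := by
    rw [hsupp]
    refine sq_sum_le_card_mul_sum_sq.trans ?_
    have : ∑ x ∈ s, ‖φ x‖ ^ 2 ≤ ∑ x, ‖φ x‖ ^ 2 :=
      Finset.sum_le_sum_of_subset_of_nonneg (Finset.subset_univ _) fun _ _ _ => by positivity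
    rw [← EuclideanSpace.norm_sq_eq, hφ] at this
    nlinarith [(Nat.cast_nonneg s.card : (0 : ℝ) ≤ s.card)]
  calc ‖braket M φ φ‖ = ‖∑ x, ∑ y, star (φ x) * (M x y * φ y)‖ := by
        simp [braket, dotProduct, Matrix.mulVec, Finset.mul_sum]
    _ ≤ ∑ x, ∑ y, ‖φ x‖ * (maxNorm M * ‖φ y‖) := by
        refine norm_sum_le_of_le _ fun x _ => norm_sum_le_of_le _ fun y _ => ?_
        rw [norm_mul, norm_mul, norm_star]
        gcongr
        exact norm_apply_le_maxNorm M x y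
    _ = (∑ x, ‖φ x‖) ^ 2 * maxNorm M := by
        rw [sq, Finset.sum_mul_sum, Finset.sum_mul]
        refine Finset.sum_congr rfl fun x _ => ?_
        rw [Finset.sum_mul]
        exact Finset.sum_congr rfl fun y _ => by ring
    _ ≤ _ := by rw [hcard]; gcongr; exact maxNorm_nonneg M

theorem ncard_tile_le (ψ : Fin n → Bip dA dB) (k : Fin n) :
    (tile (ψ k)).ncard ≤ largestTileSize ψ :=
  Finset.le_sup (f := fun i => (tile (ψ i)).ncard) (Finset.mem_univ k)

theorem one_le_largestTileSize (hn : 0 < n) (ψ : OrthonormalBasis (Fin n) ℂ (Bip dA dB)) :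
    1 ≤ largestTileSize ψ := by
  refine le_trans ?_ (ncard_tile_le ψ ⟨0, hn⟩)
  rw [Nat.one_le_iff_ne_zero, ← Nat.pos_iff_ne_zero, Set.ncard_pos]
  by_contra h
  rw [Set.not_nonempty_iff_eq_empty] at h
  have h0 : ψ ⟨0, hn⟩ = 0 := by
    ext x
    by_contra hx
    exact (h ▸ (show x ∈ tile (ψ ⟨0, hn⟩) from hx) : x ∈ (∅ : Set _))
  exact ψ.orthonormal.ne_zero _ h0

theorem ofReal_braket_re {F : BipOp dA dB} (hF : F.PosSemidef) (φ : Bip dA dB) :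
    ((braket F φ φ).re : ℂ) = braket F φ φ :=
  Complex.ext (by simp) (Complex.nonneg_iff.1 (hF.dotProduct_mulVec_nonneg φ.ofLp)).2

theorem ofReal_trace_re {F : BipOp dA dB} (hF : F.PosSemidef) : (F.trace.re : ℂ) = F.trace :=
  Complex.ext (by simp) (Complex.nonneg_iff.1 hF.trace_nonneg).2

theorem trace_re_nonneg {F : BipOp dA dB} (hF : F.PosSemidef) : 0 ≤ F.trace.re :=
  (Complex.nonneg_iff.1 hF.trace_nonneg).1

/-! ### Consequences of rigidity -/

theorem IsRigid.posterior_sub_le {c : ℝ} {ψ : OrthonormalBasis (Fin n) ℂ (Bip dA dB)}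
    (hc : IsRigid c ψ) {a : Matrix (Fin dA) (Fin dA) ℂ} {b : Matrix (Fin dB) (Fin dB) ℂ}
    (ha : a.PosSemidef) (hb : b.PosSemidef)
    (h0 : ∀ k, braket (a ⊗ₖ b) (ψ k) (ψ k) ≠ 0) (k : Fin n) :
    (braket (a ⊗ₖ b) (ψ k) (ψ k)).re / (a ⊗ₖ b).trace.re - 1 / n ≤
      c * largestTileSize ψ * disturbance ψ (a ⊗ₖ b) := by
  have hE := ha.kronecker hb
  have h := hc a b ha hb h0
  set E := a ⊗ₖ b
  set M := E.trace⁻¹ • E - (n : ℂ)⁻¹ • (1 : BipOp dA dB)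
  have hM : braket M (ψ k) (ψ k) =
      (((braket E (ψ k) (ψ k)).re / E.trace.re - 1 / n : ℝ) : ℂ) := by
    have hM' : M = E.trace⁻¹ • E + (-(n : ℂ)⁻¹) • (1 : BipOp dA dB) := by
      rw [neg_smul, ← sub_eq_add_neg]
    rw [hM', braket_add, braket_smul, braket_smul, braket_one, inner_self_eq_norm_sq_to_K,
      ψ.norm_eq_one]
    push_cast
    rw [ofReal_braket_re hE, ofReal_trace_re hE]
    simp [div_eq_inv_mul, sub_eq_add_neg]
  calc _ ≤ ‖braket M (ψ k) (ψ k)‖ := by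
        rw [hM, Complex.norm_real]; exact le_abs_self _
    _ ≤ (tile (ψ k)).ncard * maxNorm M := norm_braket_le_maxNorm _ _ (ψ.norm_eq_one k)
    _ ≤ largestTileSize ψ * (c * disturbance ψ E) := by
        gcongr
        · exact maxNorm_nonneg M
        · exact ncard_tile_le ψ k
    _ = _ := by ring

/-- The identity, with the first diagonal entry doubled. -/
noncomputable def bumpDiagonal (d : ℕ) : Matrix (Fin d) (Fin d) ℂ :=
  Matrix.diagonal fun i => if (i : ℕ) = 0 then 2 else 1

theorem bumpDiagonal_posDef (d : ℕ) : (bumpDiagonal d).PosDef := by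
  rw [bumpDiagonal, Matrix.posDef_diagonal_iff]
  intro i
  split_ifs <;> simp

theorem trace_bumpDiagonal {d : ℕ} (hd : 0 < d) : (bumpDiagonal d).trace = d + 1 := by
  obtain ⟨d, rfl⟩ := Nat.exists_eq_succ_of_ne_zero hd.ne'
  rw [bumpDiagonal, Matrix.trace_diagonal, Fin.sum_univ_succ]
  simp
  ring

/-- Rigidity is tested on one positive definite product operator away from the identity, whose
disturbance is at most 1. This makes c positive and keeps the final bound small enough to hold at a
leaf. -/
theorem IsRigid.one_le {c : ℝ} {ψ : OrthonormalBasis (Fin n) ℂ (Bip dA dB)} (hn : 2 ≤ n)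
    (hc : IsRigid c ψ) : 1 ≤ c * (3 * n) := by
  have hcard := card_eq_mul ψ
  have hA : 0 < dA := Nat.pos_of_ne_zero (by rintro rfl; simp at hcard; omega)
  have hB : 0 < dB := Nat.pos_of_ne_zero (by rintro rfl; simp at hcard; omega)
  have hE := (bumpDiagonal_posDef dA).kronecker (bumpDiagonal_posDef dB)
  have h := hc _ _ (bumpDiagonal_posDef dA).posSemidef (bumpDiagonal_posDef dB).posSemidef
    (fun i => (hE.dotProduct_mulVec_pos (x := (ψ i).ofLp) (by
      have := ψ.orthonormal.ne_zero i
      simpa using this)).ne')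
  have hent := (norm_apply_le_maxNorm _ (⟨0, hA⟩, ⟨0, hB⟩) (⟨0, hA⟩, ⟨0, hB⟩)).trans h
  have hx : (1 : ℝ) ≤ dA := by exact_mod_cast hA
  have hy : (1 : ℝ) ≤ dB := by exact_mod_cast hB
  have hnxy : (n : ℝ) = dA * dB := by exact_mod_cast hcard
  have hn2 : (2 : ℝ) ≤ n := by exact_mod_cast hn
  have hval : 1 / (3 * (n : ℝ)) ≤
      ((dA + 1) * (dB + 1) : ℝ)⁻¹ * 4 - (n : ℝ)⁻¹ := by
    rw [hnxy] at hn2 ⊢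
    rw [← sub_nonneg]
    have : ((dA + 1) * (dB + 1) : ℝ)⁻¹ * 4 - ((dA : ℝ) * dB)⁻¹ - 1 / (3 * (dA * dB)) =
        4 * (3 * (dA * dB) - (dA + 1) * (dB + 1)) / (3 * (dA * dB) * ((dA + 1) * (dB + 1))) := by
      field_simp
      ring
    rw [this]
    apply div_nonneg _ (by positivity)
    -- What remains is 2xy ≥ x + y + 1 for x = dA and y = dB, from (x - 1)(y - 1) ≥ 0 and xy ≥ 2.
    nlinarith
  have hlow : 1 / (3 * (n : ℝ)) ≤
      c * disturbance ψ (bumpDiagonal dA ⊗ₖ bumpDiagonal dB) := by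
    refine hval.trans (le_trans ?_ hent)
    rw [Matrix.trace_kronecker, trace_bumpDiagonal hA, trace_bumpDiagonal hB]
    refine le_trans (le_of_eq ?_) (Complex.re_le_norm _)
    have : (((dA : ℂ) + 1) * (dB + 1))⁻¹ = ((((dA : ℝ) + 1) * (dB + 1))⁻¹ : ℝ) := by push_cast; rfl
    have h' : ((n : ℂ))⁻¹ = ((n : ℝ)⁻¹ : ℝ) := by push_cast; rfl
    simp only [Matrix.sub_apply, Matrix.smul_apply, Matrix.one_apply_eq, smul_eq_mul,
      Matrix.kronecker_apply, bumpDiagonal, Matrix.diagonal_apply_eq, if_true, this, h']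
    norm_num [← Complex.ofReal_inv]
  have hd := disturbance_le_one hn ψ hE.posSemidef
  have hpos : 0 < 1 / (3 * (n : ℝ)) := by positivity
  have hd0 : 0 ≤ disturbance ψ (bumpDiagonal dA ⊗ₖ bumpDiagonal dB) :=
    Real.iSup_nonneg fun _ => by positivity
  have hc0 : 0 ≤ c := by
    by_contra hneg
    nlinarith
  have : 1 / (3 * (n : ℝ)) ≤ c := hlow.trans (mul_le_of_le_one_right hc0 hd)
  rwa [div_le_iff₀ (by positivity)] at this

/-! ### Error at the threshold -/

/-- How far the posterior probabilities may rise above `1 / n`. -/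
noncomputable def posteriorGap (n : ℕ) : ℝ := 2 / (3 * n * (n - 1))

theorem errorWeight_nonneg (ψ : OrthonormalBasis (Fin n) ℂ (Bip dA dB))
    (F : Fin n → BipOp dA dB) (hF : ∀ k, (F k).PosSemidef) : 0 ≤ errorWeight ψ F := by
  rw [errorWeight, ← sum_braket_re ψ, sub_nonneg]
  refine Finset.sum_le_sum fun k _ => ?_
  rw [braket_sum, Complex.re_sum]
  exact Finset.single_le_sum (f := fun l => (braket (F l) (ψ k) (ψ k)).re)
    (fun l _ => braket_re_nonneg (hF l) _) (Finset.mem_univ k)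

/-- The error bound at an event at which the largest posterior probability is exactly
`1 / n + posteriorGap n`. -/
theorem le_errorWeight_of_posterior_eq (hn : 2 ≤ n) {c : ℝ}
    (ψ : OrthonormalBasis (Fin n) ℂ (Bip dA dB)) (hc : IsRigid c ψ)
    {a : Matrix (Fin dA) (Fin dA) ℂ} {b : Matrix (Fin dB) (Fin dB) ℂ}
    (ha : a.PosSemidef) (hb : b.PosSemidef) (F : Fin n → BipOp dA dB)
    (hF : ∀ k, (F k).PosSemidef) (hsum : ∑ k, F k = a ⊗ₖ b)
    (hle : ∀ k, (braket (a ⊗ₖ b) (ψ k) (ψ k)).re ≤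
      (1 / n + posteriorGap n) * (a ⊗ₖ b).trace.re)
    (k : Fin n) (hk : (braket (a ⊗ₖ b) (ψ k) (ψ k)).re =
      (1 / n + posteriorGap n) * (a ⊗ₖ b).trace.re) :
    2 / 27 * (1 / ((c * largestTileSize ψ) ^ 2 * n ^ 5)) * (a ⊗ₖ b).trace.re ≤
      errorWeight ψ F := by
  have hE := ha.kronecker hb
  have hrigid := hc.posterior_sub_le ha hb
  have herr : ∀ i j, i ≠ j → ‖braket (a ⊗ₖ b) (ψ i) (ψ j)‖ ^ 2 ≤ _ :=
    fun i j hij => hsum ▸ norm_braket_sq_le_errorWeight ψ F hF hij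
  have hE0 := errorWeight_nonneg ψ F hF
  obtain ⟨i, j, hij, hδ⟩ := exists_disturbance_eq hn ψ (a ⊗ₖ b)
  specialize herr i j hij
  have htr := sum_braket_re ψ (a ⊗ₖ b)
  have hT0 := trace_re_nonneg hE
  generalize a ⊗ₖ b = E at *
  generalize errorWeight ψ F = err at *
  set T := E.trace.re
  rcases hT0.eq_or_lt with hT | hT
  · rw [← hT, mul_zero]; exact hE0
  have hn2 : (2 : ℝ) ≤ n := by exact_mod_cast hn
  have hn1 : (0 : ℝ) < n - 1 := by linarith
  have hn0 : (0 : ℝ) < n := by linarith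
  -- Posteriors sum to 1, so each is at least 1/n - (n - 1)g with g = `posteriorGap n`. The gap
  -- maximises g²(1/n - (n - 1)g), which leaves 1/(3n) here.
  have hmin (l : Fin n) : T / (3 * n) ≤ (braket E (ψ l) (ψ l)).re := by
    rw [← Finset.add_sum_erase _ _ (Finset.mem_univ l)] at htr
    have hs := Finset.sum_le_card_nsmul (Finset.univ.erase l)
      (fun k => (braket E (ψ k) (ψ k)).re) _ fun k _ => hle k
    rw [Finset.card_erase_of_mem (Finset.mem_univ l), Finset.card_univ, Fintype.card_fin,
      nsmul_eq_mul, Nat.cast_sub (by omega), Nat.cast_one] at hs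
    have : T - (n - 1) * ((1 / n + posteriorGap n) * T) = T / (3 * n) := by
      rw [posteriorGap]; field_simp; ring
    linarith
  have hpos (l : Fin n) : 0 < (braket E (ψ l) (ψ l)).re := (by positivity : _ < _).trans_le (hmin l)
  have hr := hrigid (fun l h => (hpos l).ne' (by rw [h, Complex.zero_re])) k
  rw [hk, mul_div_cancel_right₀ _ hT.ne', add_sub_cancel_left, hδ] at hr
  have hi := hpos i
  have hj := hpos j
  have hmi := hmin i
  have hmj := hmin j
  generalize (braket E (ψ i) (ψ i)).re = X at *
  generalize (braket E (ψ j) (ψ j)).re = Y at *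
  generalize ‖braket E (ψ i) (ψ j)‖ = z at *
  have hL : (1 : ℝ) ≤ largestTileSize ψ := by
    exact_mod_cast one_le_largestTileSize (by omega) ψ
  have hc0 : 0 < c := pos_of_mul_pos_left (zero_lt_one.trans_le (hc.one_le hn)) (by positivity)
  have hg : 0 < posteriorGap n := by rw [posteriorGap]; positivity
  have hκ : 0 < c * largestTileSize ψ := by positivity
  generalize c * (largestTileSize ψ : ℝ) = κ at *
  have h1 : posteriorGap n ^ 2 * (X * Y) ≤ κ ^ 2 * z ^ 2 := by
    have := pow_le_pow_left₀ hg.le hr 2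
    rw [mul_pow, div_pow, Real.sq_sqrt (by positivity), ← mul_div_assoc,
      le_div_iff₀ (by positivity)] at this
    exact this
  -- Half of XY is at least X · T/(6n), and the other half at least Y · T/(6n).
  have h2 : (X + Y) * (T / (6 * n)) ≤ X * Y := by
    have e : T / (6 * n) = T / (3 * n) / 2 := by field_simp; norm_num
    rw [e]
    nlinarith
  have h3 : (X + Y) * (posteriorGap n ^ 2 * (T / (6 * n))) ≤ (X + Y) * (κ ^ 2 * err) := by
    nlinarith [sq_nonneg (posteriorGap n), sq_nonneg κ]
  have h4 := le_of_mul_le_mul_left h3 (by positivity)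
  have h5 : posteriorGap n ^ 2 * (T / (6 * n)) / κ ^ 2 ≤ err := by
    rwa [div_le_iff₀ (by positivity), mul_comm err]
  have h6 : (n : ℝ) ^ 3 * (n - 1) ^ 2 ≤ n ^ 5 := by
    rw [show (n : ℝ) ^ 5 = n ^ 3 * n ^ 2 by ring]
    gcongr
    linarith
  calc 2 / 27 * (1 / (κ ^ 2 * n ^ 5)) * T
      ≤ 2 / 27 * (1 / (κ ^ 2 * (n ^ 3 * (n - 1) ^ 2))) * T := by gcongr
    _ = posteriorGap n ^ 2 * (T / (6 * n)) / κ ^ 2 := by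
      rw [posteriorGap]; field_simp; norm_num
    _ ≤ err := h5

/-! ### Reweighting and induction on the protocol -/

/-- If every event `E i` whose posterior probabilities are at most `θ` errs with probability at
least `β`, and so does every event `∑ i, E i + t E i` whose largest posterior probability is exactly
`θ`, then so does `∑ i, E i`, provided that its posterior probabilities are at most `θ`. -/
theorem le_errorWeight_sum {r : ℕ} (ψ : Fin n → Bip dA dB) (θ β : ℝ)
    (F : Fin r → Fin n → BipOp dA dB) (hF : ∀ i k, (F i k).PosSemidef)
    (E : Fin r → BipOp dA dB) (hFE : ∀ i, ∑ k, F i k = E i)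
    (child : ∀ i, (∀ k, (braket (E i) (ψ k) (ψ k)).re ≤ θ * (E i).trace.re) →
      β * (E i).trace.re ≤ errorWeight ψ (F i))
    (threshold : ∀ i (t : ℝ), 0 ≤ t → ∀ G : Fin n → BipOp dA dB, (∀ k, (G k).PosSemidef) →
      ∑ k, G k = ∑ i, E i + (t : ℂ) • E i →
      (∀ k, (braket (∑ k, G k) (ψ k) (ψ k)).re ≤ θ * (∑ k, G k).trace.re) →
      (∃ k, (braket (∑ k, G k) (ψ k) (ψ k)).re = θ * (∑ k, G k).trace.re) →
      β * (∑ k, G k).trace.re ≤ errorWeight ψ G)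
    (hle : ∀ k, (braket (∑ i, E i) (ψ k) (ψ k)).re ≤ θ * (∑ i, E i).trace.re) :
    β * (∑ i, E i).trace.re ≤ errorWeight ψ (fun k => ∑ i, F i k) := by
  by_contra! hlt
  obtain ⟨i, hi⟩ : ∃ i, errorWeight ψ (F i) < β * (E i).trace.re := by
    by_contra! h
    refine hlt.not_ge ?_
    rw [errorWeight_sum, Matrix.trace_sum, Complex.re_sum, Finset.mul_sum]
    exact Finset.sum_le_sum fun i _ => h i
  have hex : ∃ k, θ * (E i).trace.re < (braket (E i) (ψ k) (ψ k)).re := by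
    by_contra! h
    exact hi.not_ge (child i h)
  set s : Finset (Fin n) :=
    Finset.univ.filter fun k => θ * (E i).trace.re < (braket (E i) (ψ k) (ψ k)).re with hs
  have hmem (k : Fin n) : k ∈ s ↔ 0 < (braket (E i) (ψ k) (ψ k)).re - θ * (E i).trace.re := by
    simp [hs]
  obtain ⟨k₀, hk₀⟩ := hex
  -- As t grows, `l` is the first index whose posterior in ∑ E + t E_i reaches θ; indices outside
  -- `s` never exceed it.
  obtain ⟨l, hl, hmin⟩ := s.exists_min_image
    (fun k => (θ * (∑ i, E i).trace.re - (braket (∑ i, E i) (ψ k) (ψ k)).re) /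
      ((braket (E i) (ψ k) (ψ k)).re - θ * (E i).trace.re)) ⟨k₀, by rw [hmem]; linarith⟩
  rw [hmem] at hl
  set t := (θ * (∑ i, E i).trace.re - (braket (∑ i, E i) (ψ l) (ψ l)).re) /
      ((braket (E i) (ψ l) (ψ l)).re - θ * (E i).trace.re) with ht
  have ht0 : 0 ≤ t := div_nonneg (sub_nonneg.2 (hle l)) hl.le
  have hsumG : ∑ k, ((∑ i, F i k) + (t : ℂ) • F i k) = ∑ i, E i + (t : ℂ) • E i := by
    rw [Finset.sum_add_distrib, ← Finset.smul_sum, hFE, Finset.sum_comm]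
    simp_rw [hFE]
  have h := threshold i t ht0 (fun k => (∑ i, F i k) + (t : ℂ) • F i k)
    (fun k => (Matrix.posSemidef_sum _ fun i _ => hF i k).add
      ((hF i k).smul (Complex.zero_le_real.2 ht0))) hsumG
  rw [hsumG, errorWeight_add_smul] at h
  simp only [braket_add, braket_smul, Matrix.trace_add, Matrix.trace_smul, smul_eq_mul,
    Complex.add_re, Complex.re_ofReal_mul] at h
  have h' := h ?_ ⟨l, ?_⟩
  · have := mul_le_mul_of_nonneg_left hi.le ht0
    linarith
  · intro k
    by_cases hk : k ∈ s
    · have h1 := hmin k hk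
      rw [hmem] at hk
      rw [le_div_iff₀ hk] at h1
      linarith
    · rw [hmem, not_lt] at hk
      have := mul_le_mul_of_nonneg_left hk ht0
      linarith [hle k]
  · have : t * ((braket (E i) (ψ l) (ψ l)).re - θ * (E i).trace.re) = _ := div_mul_cancel₀ _ hl.ne'
    linarith

theorem Protocol.le_errorWeight (hn : 2 ≤ n) {DA DB : ℕ} {c : ℝ}
    (ψ : OrthonormalBasis (Fin n) ℂ (Bip DA DB)) (hc : IsRigid c ψ)
    {dA dB : ℕ} (P : Protocol (Fin n) dA dB) (A : Matrix (Fin dA) (Fin DA) ℂ)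
    (B : Matrix (Fin dB) (Fin DB) ℂ)
    (hle : ∀ k, (braket ((Aᴴ * A) ⊗ₖ (Bᴴ * B)) (ψ k) (ψ k)).re ≤
      (1 / n + posteriorGap n) * ((Aᴴ * A) ⊗ₖ (Bᴴ * B)).trace.re) :
    2 / 27 * (1 / ((c * largestTileSize ψ) ^ 2 * n ^ 5)) * ((Aᴴ * A) ⊗ₖ (Bᴴ * B)).trace.re ≤
      errorWeight ψ (fun k => P.leafSum k A B) := by
  have hA {d D : ℕ} (A : Matrix (Fin d) (Fin D) ℂ) := Matrix.posSemidef_conjTranspose_mul_self A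
  induction P with
  | output j =>
    have hsum := Protocol.sum_leafSum (Protocol.output j : Protocol (Fin n) _ _) A B
    have hT := trace_re_nonneg ((hA A).kronecker (hA B))
    have hj : ∑ k, (braket ((Protocol.output j : Protocol (Fin n) _ _).leafSum k A B)
        (ψ k) (ψ k)).re = (braket ((Aᴴ * A) ⊗ₖ (Bᴴ * B)) (ψ j) (ψ j)).re := by
      rw [Finset.sum_eq_single j]
      · simp [Protocol.leafSum]
      · intro k _ hk
        simp [Protocol.leafSum, hk.symm, braket]
      · simp
    rw [errorWeight, hsum, hj]
    refine le_trans ?_ (sub_le_sub_left (hle j) _)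
    rw [← one_sub_mul]
    gcongr
    have hn2 : (2 : ℝ) ≤ n := by exact_mod_cast hn
    have hn1 : (0 : ℝ) < n - 1 := by linarith
    have hL : (1 : ℝ) ≤ largestTileSize ψ := by
      exact_mod_cast one_le_largestTileSize (by omega) ψ
    have hc1 := hc.one_le hn
    have hc0 : 0 < c := pos_of_mul_pos_left (zero_lt_one.trans_le hc1) (by positivity)
    have hκ : 1 ≤ c * largestTileSize ψ * (3 * n) := by nlinarith
    generalize c * (largestTileSize ψ : ℝ) = κ at *
    -- From κn ≥ 1/3 and n³ ≥ 8. The bound is then at most 1/12, while 1 - θ ≥ 1 - 1/2 - 1/3 = 1/6.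
    have h1 : 8 / 9 ≤ κ ^ 2 * (n : ℝ) ^ 5 := by
      have : (8 : ℝ) ≤ (n : ℝ) ^ 3 := by
        calc (8 : ℝ) = 2 ^ 3 := by norm_num
          _ ≤ _ := by gcongr
      nlinarith [one_le_pow₀ hκ (n := 2)]
    have h2 : 2 / 27 * (1 / (κ ^ 2 * (n : ℝ) ^ 5)) ≤ 1 / 12 := by
      have := one_div_le_one_div_of_le (by norm_num) h1
      linarith
    have h3 : (1 : ℝ) / n ≤ 1 / 2 := one_div_le_one_div_of_le (by norm_num) hn2
    have h4 : posteriorGap n ≤ 1 / 3 := by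
      rw [posteriorGap, div_le_div_iff₀ (by positivity) (by norm_num)]
      nlinarith
    linarith
  | alice r d' M hM next ih =>
    have hE : (Aᴴ * A) ⊗ₖ (Bᴴ * B) = ∑ i, ((M i * A)ᴴ * (M i * A)) ⊗ₖ (Bᴴ * B) := by
      rw [← sum_conjTranspose_mul_self_mul M hM A, sum_kronecker]
    simp only [Protocol.leafSum]
    rw [hE] at hle ⊢
    refine le_errorWeight_sum ψ (1 / n + posteriorGap n) _ _
      (fun i k => (next i).leafSum_posSemidef k _ _) _ (fun i => (next i).sum_leafSum _ _)
      (fun i => ih i _ _) ?_ hle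
    rintro i t ht G hG hsum hGle ⟨k, hk⟩
    -- Bob's factor is common to all children, so extra weight on one of them changes only Alice's
    -- factor.
    have hprod : ∑ k, G k = (Aᴴ * A + (t : ℂ) • ((M i * A)ᴴ * (M i * A))) ⊗ₖ (Bᴴ * B) := by
      rw [hsum, Matrix.add_kronecker, Matrix.smul_kronecker, hE]
    rw [hprod] at hGle hk ⊢
    exact le_errorWeight_of_posterior_eq hn ψ hc
      ((hA A).add ((hA _).smul (Complex.zero_le_real.2 ht))) (hA B) G hG hprod hGle k hk
  | bob r d' M hM next ih =>
    have hE : (Aᴴ * A) ⊗ₖ (Bᴴ * B) = ∑ i, (Aᴴ * A) ⊗ₖ ((M i * B)ᴴ * (M i * B)) := by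
      rw [← sum_conjTranspose_mul_self_mul M hM B, kronecker_sum]
    simp only [Protocol.leafSum]
    rw [hE] at hle ⊢
    refine le_errorWeight_sum ψ (1 / n + posteriorGap n) _ _
      (fun i k => (next i).leafSum_posSemidef k _ _) _ (fun i => (next i).sum_leafSum _ _)
      (fun i => ih i _ _) ?_ hle
    rintro i t ht G hG hsum hGle ⟨k, hk⟩
    have hprod : ∑ k, G k = (Aᴴ * A) ⊗ₖ (Bᴴ * B + (t : ℂ) • ((M i * B)ᴴ * (M i * B))) := by
      rw [hsum, Matrix.kronecker_add, Matrix.kronecker_smul, hE]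
    rw [hprod] at hGle hk ⊢
    exact le_errorWeight_of_posterior_eq hn ψ hc
      (hA A) ((hA B).add ((hA _).smul (Complex.zero_le_real.2 ht))) G hG hprod hGle k hk

end BipartiteLOCC

theorem mainTheorem5 (dA dB n : ℕ) (hn : 2 ≤ n)
    (ψ : OrthonormalBasis (Fin n) ℂ (BipartiteLOCC.Bip dA dB))
    (c : ℝ) (hc : BipartiteLOCC.IsRigid c ψ)
    (E : Fin n → BipartiteLOCC.BipOp dA dB) (hE : BipartiteLOCC.IsLOCCMeasurement E) :
    BipartiteLOCC.errorProb ψ E ≥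
      (2 / 27) * (1 / ((c * (BipartiteLOCC.largestTileSize ψ : ℝ)) ^ 2 * (n : ℝ) ^ 5)) := by
  obtain ⟨P, hP⟩ := hE
  have hn2 : (2 : ℝ) ≤ n := by exact_mod_cast hn
  have hn1 : (0 : ℝ) < n - 1 := by linarith
  have hn0 : (0 : ℝ) < n := by linarith
  have hone : ((1 : Matrix (Fin dA) (Fin dA) ℂ)ᴴ * 1) ⊗ₖ ((1 : Matrix (Fin dB) (Fin dB) ℂ)ᴴ * 1)
      = 1 := by simp
  have htr : (1 : BipartiteLOCC.BipOp dA dB).trace.re = n := by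
    rw [Matrix.trace_one, Fintype.card_prod, Fintype.card_fin, Fintype.card_fin,
      ← BipartiteLOCC.card_eq_mul ψ, Complex.natCast_re]
  have h := P.le_errorWeight hn ψ hc 1 1 (by
    intro k
    rw [hone, htr, BipartiteLOCC.braket_one, inner_self_eq_norm_sq_to_K, ψ.norm_eq_one, add_mul,
      one_div, inv_mul_cancel₀ hn0.ne']
    have : 0 < BipartiteLOCC.posteriorGap n := by rw [BipartiteLOCC.posteriorGap]; positivity
    norm_num
    positivity)
  -- At the root the event is the identity, of trace n, so dividing by n turns the error weight into
  -- the error probability.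
  rw [BipartiteLOCC.errorWeight, P.sum_leafSum, hone, htr] at h
  have hp (k : Fin n) : E k = P.leafSum k 1 1 := hP k
  simp_rw [← hp] at h
  rw [BipartiteLOCC.errorProb, ge_iff_le, ← le_div_iff₀ hn0] at *
  refine h.trans (le_of_eq ?_)
  field_simp
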